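/- Let $m\ge 2$ be an integer and let $G$ be a profinite group. All cohomology groups are continuous (profinite) cohomology groups with trivial coefficients $\mathbb Z/m$; in particular $H^1(K,\mathbb Z/m)=\mathrm{Hom}_{\mathrm{cont}}(K,\mathbb Z/m)$. Assume the following condition: (KF1) for every open normal subgroup $N$ of $G$ and every $\chi\in H^1(N,\mathbb Z/m)$ the sequence $$H^1(\ker\chi,\mathbb Z/m)\xrightarrow{\ \mathrm{Cor}_N\ }H^1(N,\mathbb Z/m)\xrightarrow{\ \cup\chi\ }H^2(N,\mathbb Z/m)\xrightarrow{\ \mathrm{Res}_{\ker\chi}\ }H^2(\ker\chi,\mathbb Z/m)$$ is exact. Let $\mathbb U_3(\mathbb Z/m)$ be the group of unitriangular (upper triangular with $1$'s on the diagonal) $4\times4$-matrices over $\mathbb Z/m$, let $E_{ij}$ be the matrix with $1$ at entry $(i,j)$ and $0$ elsewhere, and let $\bar{\mathbb U}_3(\mathbb Z/m)$ be the quotient of $\mathbb U_3(\mathbb Z/m)$ by the central subgroup $\{I+rE_{14}: r\in\mathbb Z/m\}\cong\mathbb Z/m$; its elements are viewed as unitriangular matrices with the $(1,4)$-entry omitted.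 Let $\alpha\in H^2(\bar{\mathbb U}_3(\mathbb Z/m),\mathbb Z/m)$ be the class of the central extension $$0\to\mathbb Z/m\to\mathbb U_3(\mathbb Z/m)\to\bar{\mathbb U}_3(\mathbb Z/m)\to1 .$$ Let $\bar\rho\colon G\to\bar{\mathbb U}_3(\mathbb Z/m)$ be a continuous homomorphism, and for $(i,j)\ne(1,4)$ let $\bar\rho_{ij}\colon G\to\mathbb Z/m$ be its $(i,j)$-entry; $\bar\rho_{12}$ and $\bar\rho_{34}$ are homomorphisms. Put $M_1=\ker\bar\rho_{12}$, $M_3=\ker\bar\rho_{34}$, $M=M_1\cap M_3$, and let $\omega=\mathrm{Res}_{M_1}(\bar\rho_{13})$, which is a homomorphism $M_1\to\mathbb Z/m$, viewed as an element of $H^1(M_1,\mathbb Z/m)$. Then the following conditions are equivalent: (a) $\mathrm{Res}_{M_1}(\bar\rho^*\alpha)=0$ in $H^2(M_1,\mathbb Z/m)$; (b) there exists a continuous homomorphism $\lambda\colon G\to\mathbb Z/m$ such that the continuous homomorphism $\bar\rho(I-\lambda E_{24})\colon G\to\bar{\mathbb U}_3(\mathbb Z/m)$, $g\mapsto\bar\rho(g)(I-\lambda(g)E_{24})$,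 satisfies $(\bar\rho(I-\lambda E_{24}))^*\alpha=0$ in $H^2(G,\mathbb Z/m)$; (c) $\omega\in\mathrm{Cor}_{M_1}\bigl(H^1(M,\mathbb Z/m)\bigr)$. -/

import Mathlib

open scoped Pointwise

noncomputable section

namespace UniTri

/-! ### Continuous cohomology in degrees 1 and 2 with trivial coefficients `ℤ/m`

`ZMod m` carries the discrete topology (the Mathlib instance).  We use the complex of continuous
inhomogeneous cochains; since the action is trivial, there are no nonzero 1-coboundaries. -/

section Cohomology

variable (m : ℕ) (G : Type*) [Group G] [TopologicalSpace G]

/-- `H¹(G, ℤ/m) = Hom_cont(G, ℤ/m)`. -/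
def H1 : AddSubgroup (G → ZMod m) where
  carrier := {f | Continuous f ∧ ∀ g h, f (g * h) = f g + f h}
  zero_mem' := ⟨continuous_const, by simp⟩
  add_mem' := by
    rintro a b ⟨ha, ha'⟩ ⟨hb, hb'⟩
    refine ⟨ha.add hb, fun g h => ?_⟩
    simp only [Pi.add_apply, ha', hb']
    abel
  neg_mem' := by
    rintro a ⟨ha, ha'⟩
    refine ⟨ha.neg, fun g h => ?_⟩
    simp only [Pi.neg_apply, ha']
    abel

/-- Continuous inhomogeneous 2-cocycles `G × G → ℤ/m`. -/
def Z2 : AddSubgroup (G × G → ZMod m) where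
  carrier := {f | Continuous f ∧
    ∀ g h k, f (h, k) - f (g * h, k) + f (g, h * k) - f (g, h) = 0}
  zero_mem' := ⟨continuous_const, by simp⟩
  add_mem' := by
    rintro a b ⟨ha, ha'⟩ ⟨hb, hb'⟩
    refine ⟨ha.add hb, fun g h k => ?_⟩
    simp only [Pi.add_apply]
    linear_combination ha' g h k + hb' g h k
  neg_mem' := by
    rintro a ⟨ha, ha'⟩
    refine ⟨ha.neg, fun g h k => ?_⟩
    simp only [Pi.neg_apply]
    linear_combination -ha' g h k

/-- The 2-coboundaries: `(g, h) ↦ c h - c (g h) + c g` with `c : G → ℤ/m` continuous. -/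
def B2 : AddSubgroup (G × G → ZMod m) where
  carrier := {f | ∃ c : G → ZMod m, Continuous c ∧
    ∀ g h, f (g, h) = c h - c (g * h) + c g}
  zero_mem' := ⟨0, continuous_const, by simp⟩
  add_mem' := by
    rintro a b ⟨c, hc, hac⟩ ⟨d, hd, hbd⟩
    refine ⟨c + d, hc.add hd, fun g h => ?_⟩
    simp only [Pi.add_apply, hac, hbd]
    abel
  neg_mem' := by
    rintro a ⟨c, hc, hac⟩
    refine ⟨-c, hc.neg, fun g h => ?_⟩
    simp only [Pi.neg_apply, hac]
    abel

/-- `H²(G, ℤ/m)`: continuous 2-cocycles modulo 2-coboundaries. -/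
abbrev H2 : Type _ := Z2 m G ⧸ (B2 m G).addSubgroupOf (Z2 m G)

variable {m G}
variable {K : Type*} [Group K] [TopologicalSpace K]

/-- Pullback `φ^* : H¹(K, ℤ/m) → H¹(G, ℤ/m)` along a continuous homomorphism `φ : G → K`. -/
def H1.map (φ : G →ₜ* K) : H1 m K →+ H1 m G where
  toFun f := ⟨fun g => f.1 (φ g), f.2.1.comp φ.continuous_toFun, fun g h => by
    simp only [map_mul, f.2.2]⟩
  map_zero' := rfl
  map_add' _ _ := rfl

/-- Pullback of 2-cocycles along a continuous homomorphism. -/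
def Z2.map (φ : G →ₜ* K) : Z2 m K →+ Z2 m G where
  toFun f := ⟨fun p => f.1 (φ p.1, φ p.2),
    f.2.1.comp ((φ.continuous_toFun.comp continuous_fst).prodMk
      (φ.continuous_toFun.comp continuous_snd)),
    fun g h k => by simpa only [map_mul] using f.2.2 (φ g) (φ h) (φ k)⟩
  map_zero' := rfl
  map_add' _ _ := rfl

/-- Pullback `φ^* : H²(K, ℤ/m) → H²(G, ℤ/m)` along a continuous homomorphism `φ : G → K`. -/
def H2.map (φ : G →ₜ* K) : H2 m K →+ H2 m G :=
  QuotientAddGroup.map _ _ (Z2.map φ) (by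
    rintro f ⟨c, hc, hf⟩
    exact ⟨fun g => c (φ g), hc.comp φ.continuous_toFun, fun g h => by
      have h' := hf (φ g) (φ h)
      rw [← map_mul] at h'
      exact h'⟩)

/-- The continuous inclusion of a subgroup. -/
def incl (H : Subgroup G) : H →ₜ* G where
  toMonoidHom := H.subtype
  continuous_toFun := continuous_subtype_val

/-- Restriction `Res_H : H¹(G, ℤ/m) → H¹(H, ℤ/m)`. -/
def H1.res (H : Subgroup G) : H1 m G →+ H1 m H := H1.map (incl H)

/-- Restriction `Res_H : H²(G, ℤ/m) → H²(H, ℤ/m)`. -/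
def H2.res (H : Subgroup G) : H2 m G →+ H2 m H := H2.map (incl H)

/-- The cup product with `χ` on the right, `ψ ↦ ψ ∪ χ`, `H¹(G, ℤ/m) → H²(G, ℤ/m)`; it is induced
by the cochain `(g, h) ↦ ψ(g) χ(h)`. -/
def cupRight (χ : H1 m G) : H1 m G →+ H2 m G :=
  (QuotientAddGroup.mk' ((B2 m G).addSubgroupOf (Z2 m G))).comp
    { toFun := fun ψ => ⟨fun p => ψ.1 p.1 * χ.1 p.2,
        (ψ.2.1.comp continuous_fst).mul (χ.2.1.comp continuous_snd),
        fun g h k => by simp only [ψ.2.2, χ.2.2]; ring⟩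
      map_zero' := by ext p; simp
      map_add' := fun a b => by ext p; simp [add_mul] }

/-- An element of `H¹(G, ℤ/m)` as a homomorphism to the multiplicatively written group `ℤ/m`. -/
def H1.toHom (χ : H1 m G) : G →* Multiplicative (ZMod m) :=
  MonoidHom.mk' (fun g => Multiplicative.ofAdd (χ.1 g)) (fun g h => by
    rw [χ.2.2, ofAdd_add])

/-- `Ker χ` for `χ ∈ H¹(G, ℤ/m)`. -/
def H1.ker (χ : H1 m G) : Subgroup G := (H1.toHom χ).ker

theorem H1.mem_ker {χ : H1 m G} {g : G} : g ∈ H1.ker χ ↔ χ.1 g = 0 := Iff.rfl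

theorem H1.isOpen_ker (χ : H1 m G) : IsOpen (H1.ker χ : Set G) :=
  (isOpen_discrete ({0} : Set (ZMod m))).preimage χ.2.1

instance H1.finiteIndex_ker [NeZero m] (χ : H1 m G) : (H1.ker χ).FiniteIndex :=
  inferInstanceAs (H1.toHom χ).ker.FiniteIndex

/-- The transfer of a continuous homomorphism on an open subgroup is continuous. -/
theorem continuous_transfer [IsTopologicalGroup G] (H : Subgroup G) [H.FiniteIndex]
    (hH : IsOpen (H : Set G)) (f : H1 m H) :
    Continuous fun g => ((H1.toHom f).transfer g).toAdd := by
  classical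
  have : DiscreteTopology (G ⧸ H) := QuotientGroup.discreteTopology hH
  simp only [MonoidHom.transfer_def _ (default : H.LeftTransversal),
    Subgroup.leftTransversals.diff, toAdd_prod]
  refine continuous_finsetSum _ fun q _ => f.2.1.comp (Continuous.subtype_mk ?_ _)
  simp only [Subgroup.smul_apply_eq_smul_apply_inv_smul, smul_eq_mul]
  refine continuous_const.mul (continuous_id.mul ?_)
  have h1 : Continuous fun g : G => g⁻¹ • q := by
    induction q using QuotientGroup.induction_on with
    | H x => exact QuotientGroup.continuous_mk.comp (continuous_inv.mul continuous_const)
  exact (continuous_of_discreteTopology (f := fun p : G ⧸ H =>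
    (((default : H.LeftTransversal).2.leftQuotientEquiv p : _) : G))).comp h1

/-- Corestriction `Cor_G : H¹(H, ℤ/m) → H¹(G, ℤ/m)` for an open subgroup `H` of finite index:
on homomorphisms into a trivial module, it is the transfer
`(Cor f)(g) = ∑_{x ∈ G/H} f(s(x)⁻¹ · g · s(g⁻¹x))`, where `s` is any system of representatives. -/
def H1.cor [IsTopologicalGroup G] (H : Subgroup G) [H.FiniteIndex] (hH : IsOpen (H : Set G)) :
    H1 m H →+ H1 m G where
  toFun f := ⟨fun g => ((H1.toHom f).transfer g).toAdd, continuous_transfer H hH f, fun g h => by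
    simp only [map_mul, toAdd_mul]⟩
  map_zero' := by
    ext g
    simp [MonoidHom.transfer_def _ default, Subgroup.leftTransversals.diff, H1.toHom]
  map_add' a b := by
    ext g
    simp [MonoidHom.transfer_def _ default, Subgroup.leftTransversals.diff, H1.toHom,
      Finset.sum_add_distrib]

variable (m G)

/-- The exact sequence
`H¹(Ker χ) --Cor--> H¹(G) --∪χ--> H²(G) --Res--> H²(Ker χ)` for every `χ ∈ H¹(G, ℤ/m)`. -/
def CorCupResExact [NeZero m] [IsTopologicalGroup G] : Prop :=
  ∀ χ : H1 m G,
    Function.Exact (H1.cor (m := m) (H1.ker χ) (H1.isOpen_ker χ)) (cupRight χ) ∧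
    Function.Exact (cupRight χ) (H2.res (m := m) (H1.ker χ))

/-- Condition (KF1): the corestriction–cup product–restriction sequence is exact for every
open normal subgroup `M` of `G` and every `χ ∈ H¹(M, ℤ/m)`. -/
def KF1 [NeZero m] [IsTopologicalGroup G] : Prop :=
  ∀ M : Subgroup G, M.Normal → IsOpen (M : Set G) → CorCupResExact m M

end Cohomology

/-! ### The class of a central extension -/

section Schreier

variable {m : ℕ} {E Q : Type*} [Group E] [Group Q]
  (S : GroupExtension (Multiplicative (ZMod m)) E Q)

theorem exists_factorSet (σ : S.Section) (x y : Q) :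
    ∃ r : ZMod m, S.inl (Multiplicative.ofAdd r) = σ x * σ y * (σ (x * y))⁻¹ := by
  have h : σ x * σ y * (σ (x * y))⁻¹ ∈ S.inl.range := by
    rw [S.range_inl_eq_ker_rightHom, MonoidHom.mem_ker]
    simp
  obtain ⟨r, hr⟩ := h
  exact ⟨r.toAdd, hr⟩

/-- The factor set `(x, y) ↦ σ(x) σ(y) σ(xy)⁻¹ ∈ ℤ/m` of a set-theoretic section `σ`. -/
def factorSet (σ : S.Section) (p : Q × Q) : ZMod m := (exists_factorSet S σ p.1 p.2).choose

theorem inl_factorSet (σ : S.Section) (x y : Q) :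
    S.inl (Multiplicative.ofAdd (factorSet S σ (x, y))) = σ x * σ y * (σ (x * y))⁻¹ :=
  (exists_factorSet S σ x y).choose_spec

variable [TopologicalSpace Q] [DiscreteTopology Q]

theorem factorSet_mem (hS : S.inl.range ≤ Subgroup.center E) (σ : S.Section) :
    factorSet S σ ∈ Z2 m Q := by
  refine ⟨continuous_of_discreteTopology, fun g h k => ?_⟩
  have e : S.inl (Multiplicative.ofAdd (factorSet S σ (h, k) + factorSet S σ (g, h * k))) =
      S.inl (Multiplicative.ofAdd (factorSet S σ (g, h) + factorSet S σ (g * h, k))) := by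
    have c := Subgroup.mem_center_iff.1 (hS ⟨Multiplicative.ofAdd (factorSet S σ (h, k)), rfl⟩) (σ g)
    rw [inl_factorSet] at c
    rw [add_comm, ofAdd_add, ofAdd_add, map_mul, map_mul]
    simp only [inl_factorSet]
    rw [mul_assoc g h k]
    calc _ = σ g * σ (h * k) * (σ h * σ k * (σ (h * k))⁻¹) * (σ (g * (h * k)))⁻¹ := ?_
      _ = _ := ?_
    · have c' := Subgroup.mem_center_iff.1
        (hS ⟨Multiplicative.ofAdd (factorSet S σ (h, k)), rfl⟩) ((σ (g * (h * k)))⁻¹)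
      rw [inl_factorSet] at c'
      rw [mul_assoc, c', ← mul_assoc]
    · have c' := Subgroup.mem_center_iff.1
        (hS ⟨Multiplicative.ofAdd (factorSet S σ (h, k)), rfl⟩) (σ (h * k))
      rw [inl_factorSet] at c'
      rw [mul_assoc (σ g), c']
      group
  have e' := Multiplicative.ofAdd.injective (S.inl_injective e)
  linear_combination e'

/-- A set-theoretic section. -/
def someSection : S.Section := ⟨Function.surjInv S.rightHom_surjective,
  Function.rightInverse_surjInv S.rightHom_surjective⟩

/-- The class in `H²(Q, ℤ/m)` of a central extension `0 → ℤ/m → E → Q → 1` of a discrete group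
`Q` under the Schreier correspondence: the class of the factor set of a section. -/
def extClass (hS : S.inl.range ≤ Subgroup.center E) : H2 m Q :=
  QuotientAddGroup.mk ⟨factorSet S (someSection S), factorSet_mem S hS _⟩

/-- The class does not depend on the section. -/
theorem extClass_eq (hS : S.inl.range ≤ Subgroup.center E) (σ : S.Section) :
    extClass S hS = QuotientAddGroup.mk ⟨factorSet S σ, factorSet_mem S hS σ⟩ := by
  set τ := someSection S
  have hc : ∀ x, ∃ r : ZMod m, S.inl (Multiplicative.ofAdd r) = σ x * (τ x)⁻¹ := by
    intro x
    have h : σ x * (τ x)⁻¹ ∈ S.inl.range := by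
      rw [S.range_inl_eq_ker_rightHom, MonoidHom.mem_ker]
      simp
    obtain ⟨r, hr⟩ := h
    exact ⟨r.toAdd, hr⟩
  choose c hc using hc
  refine QuotientAddGroup.eq.2 ⟨c, continuous_of_discreteTopology, fun g h => ?_⟩
  change -factorSet S τ (g, h) + factorSet S σ (g, h) = _
  have hσ : ∀ x, σ x = S.inl (Multiplicative.ofAdd (c x)) * τ x := fun x => by
    rw [hc]; group
  have hz : ∀ (r : Multiplicative (ZMod m)) (y : E), y * S.inl r = S.inl r * y := fun r y =>
    Subgroup.mem_center_iff.1 (hS ⟨r, rfl⟩) y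
  have e : S.inl (Multiplicative.ofAdd (factorSet S σ (g, h) + c (g * h))) =
      S.inl (Multiplicative.ofAdd (c g + c h + factorSet S τ (g, h))) := by
    simp only [ofAdd_add, map_mul]
    rw [inl_factorSet, inl_factorSet, hσ g, hσ h, hσ (g * h), mul_inv_rev]
    have h1 := hz (Multiplicative.ofAdd (c h)) (τ g)
    generalize S.inl (Multiplicative.ofAdd (c (g * h))) = z
    calc _ = S.inl (Multiplicative.ofAdd (c g)) * (τ g * S.inl (Multiplicative.ofAdd (c h))) *
          τ h * (τ (g * h))⁻¹ := by group
      _ = _ := by rw [h1]; group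
  have e' := Multiplicative.ofAdd.injective (S.inl_injective e)
  linear_combination e'

end Schreier

/-! ### Unitriangular `4 × 4`-matrices

Rows and columns are indexed by `Fin 4 = {0, 1, 2, 3}`, so the entry `(i, j)` of the usual
`1`-based notation is the entry `(i - 1, j - 1)` here. -/

section Matrices

variable (R : Type*) [CommRing R]

/-- The group `𝕌₃(R)` of unitriangular `4 × 4`-matrices. -/
def U3 : Subgroup (GL (Fin 4) R) where
  carrier := {A | (∀ i, A.1 i i = 1) ∧ ∀ i j, j < i → A.1 i j = 0}
  one_mem' := by
    refine ⟨by simp, fun i j h => ?_⟩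
    simp [h.ne']
  mul_mem' := by
    rintro A B ⟨hA, hA'⟩ ⟨hB, hB'⟩
    constructor
    · intro i
      rw [Units.val_mul, Matrix.mul_apply, Finset.sum_eq_single i, hA, hB, one_mul]
      · intro k _ hk
        rcases lt_or_gt_of_ne hk with h | h
        · rw [hA' i k h, zero_mul]
        · rw [hB' k i h, mul_zero]
      · simp
    · intro i j hij
      rw [Units.val_mul, Matrix.mul_apply]
      refine Finset.sum_eq_zero fun k _ => ?_
      rcases lt_or_ge k i with h | h
      · rw [hA' i k h, zero_mul]
      · rw [hB' k j (hij.trans_le h), mul_zero]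
  inv_mem' := by
    rintro A ⟨hA, hA'⟩
    have : Invertible A.1 := A.invertible
    have ht : ∀ i j, j < i → (A⁻¹).1 i j = 0 := by
      have h := Matrix.blockTriangular_inv_of_blockTriangular (M := A.1) (b := id)
        (fun i j h => hA' i j h)
      intro i j hij
      rw [Matrix.coe_units_inv]
      exact h hij
    refine ⟨fun i => ?_, ht⟩
    have h1 : (A.1 * (A⁻¹).1) i i = 1 := by rw [← Units.val_mul]; simp
    rw [Matrix.mul_apply, Finset.sum_eq_single i, hA, one_mul] at h1
    · exact h1
    · intro k _ hk
      rcases lt_or_gt_of_ne hk with h | h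
      · rw [hA' i k h, zero_mul]
      · rw [ht k i h, mul_zero]
    · simp

variable {R}

theorem one_add_single_mul (i j : Fin 4) (h : i < j) (r s : R) :
    (1 + Matrix.single i j r) * (1 + Matrix.single i j s) = 1 + Matrix.single i j (r + s) :=
  Matrix.transvection_mul_transvection_same i j h.ne r s

/-- The homomorphism `R⁺ → 𝕌₃(R)`, `r ↦ I + r E_{ij}`, for `i < j`. -/
def elem (i j : Fin 4) (h : i < j) : Multiplicative R →* U3 R where
  toFun r := ⟨⟨1 + Matrix.single i j r.toAdd, 1 + Matrix.single i j (-r.toAdd),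
      by rw [one_add_single_mul i j h, add_neg_cancel, Matrix.single_zero, add_zero],
      by rw [one_add_single_mul i j h, neg_add_cancel, Matrix.single_zero, add_zero]⟩, by
    refine ⟨fun k => ?_, fun k l hkl => ?_⟩
    · change (1 + Matrix.single i j r.toAdd) k k = 1
      rw [Matrix.add_apply, Matrix.one_apply_eq, Matrix.single_apply, if_neg, add_zero]
      rintro ⟨rfl, rfl⟩
      exact h.ne rfl
    · change (1 + Matrix.single i j r.toAdd) k l = 0
      rw [Matrix.add_apply, Matrix.one_apply_ne hkl.ne', Matrix.single_apply, if_neg, add_zero]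
      rintro ⟨rfl, rfl⟩
      exact h.asymm hkl⟩
  map_one' := by
    ext
    simp
  map_mul' r s := by
    refine Subtype.ext (Units.ext ?_)
    exact (one_add_single_mul i j h r.toAdd s.toAdd).symm

variable (R) in
/-- The image of `R⁺` in `𝕌₃(R)`: the matrices `I + r E_{14}`. -/
def corner : Subgroup (U3 R) := (elem (R := R) 0 3 (by decide)).range

theorem mul_elem_apply (A : U3 R) (r : Multiplicative R) (i j k l : Fin 4) (h : i < j) :
    (A * elem i j h r).1.1 k l = A.1.1 k l + if l = j then A.1.1 k i * r.toAdd else 0 := by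
  change (A.1.1 * (1 + Matrix.single i j r.toAdd)) k l = _
  rw [mul_add, mul_one, Matrix.add_apply]
  split_ifs with hl
  · subst hl; simp
  · rw [Matrix.mul_single_apply_of_ne (hbj := hl)]

theorem elem_mul_apply (A : U3 R) (r : Multiplicative R) (i j k l : Fin 4) (h : i < j) :
    (elem i j h r * A).1.1 k l = A.1.1 k l + if k = i then r.toAdd * A.1.1 j l else 0 := by
  change ((1 + Matrix.single i j r.toAdd) * A.1.1) k l = _
  rw [add_mul, one_mul, Matrix.add_apply]
  split_ifs with hl
  · subst hl; simp
  · rw [Matrix.single_mul_apply_of_ne (h := hl)]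

theorem U3.ext' {A B : U3 R} (h : ∀ i j, A.1.1 i j = B.1.1 i j) : A = B :=
  Subtype.ext (Units.ext (Matrix.ext h))

theorem corner_le_center : corner R ≤ Subgroup.center (U3 R) := by
  rintro _ ⟨r, rfl⟩
  refine Subgroup.mem_center_iff.2 fun A => U3.ext' fun k l => ?_
  rw [mul_elem_apply, elem_mul_apply]
  have h1 := A.2.1
  have h2 := A.2.2
  congr 1
  fin_cases k <;> fin_cases l <;> simp [h1, h2]

instance corner_normal : (corner R).Normal :=
  ⟨fun n hn g => by
    rw [Subgroup.mem_center_iff.1 (corner_le_center hn) g, mul_inv_cancel_right]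
    exact hn⟩

variable (R) in
/-- `𝕌̄₃(R) = 𝕌₃(R) / R⁺`. -/
def Ubar3 : Type _ := U3 R ⧸ corner R

instance : Group (Ubar3 R) := inferInstanceAs (Group (U3 R ⧸ corner R))

/-- `𝕌̄₃(R)` is regarded as a discrete group (it is used for finite `R`). -/
instance : TopologicalSpace (Ubar3 R) := ⊥

instance : DiscreteTopology (Ubar3 R) := ⟨rfl⟩

variable (R) in
/-- The projection `π : 𝕌₃(R) → 𝕌̄₃(R)`. -/
def proj : U3 R →* Ubar3 R := QuotientGroup.mk' (corner R)

theorem proj_surjective : Function.Surjective (proj R) :=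
  QuotientGroup.mk'_surjective (corner R)

/-- The projection `pr_{ij} : 𝕌̄₃(R) → R` on an entry other than the upper right one. -/
def pr (i j : Fin 4) (h : (i, j) ≠ (0, 3)) : Ubar3 R → R :=
  Quotient.lift (fun A : U3 R => A.1.1 i j) (by
    intro A B hAB
    obtain ⟨r, hr⟩ := QuotientGroup.leftRel_apply.1 hAB
    have hB : B = A * elem 0 3 (by decide) r := by rw [hr, mul_inv_cancel_left]
    change A.1.1 i j = B.1.1 i j
    rw [hB, mul_elem_apply]
    split_ifs with hj
    · subst hj
      have hi : 0 < i := Fin.pos_of_ne_zero fun h0 => h (by rw [h0])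
      rw [A.2.2 i 0 hi, zero_mul, add_zero]
    · rw [add_zero])

@[simp] theorem pr_proj (i j : Fin 4) (h : (i, j) ≠ (0, 3)) (A : U3 R) :
    pr i j h (proj R A) = A.1.1 i j := rfl

/-- The homomorphism `R⁺ → 𝕌̄₃(R)`, `r ↦ I + r E_{24}`. -/
def elem24 : Multiplicative R →* Ubar3 R := (proj R).comp (elem 1 3 (by decide))

theorem elem24_comm (r : Multiplicative R) (x : Ubar3 R) : x * elem24 r = elem24 r * x := by
  obtain ⟨A, rfl⟩ := proj_surjective x
  change proj R A * proj R (elem 1 3 _ r) = proj R (elem 1 3 _ r) * proj R A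
  rw [← map_mul, ← map_mul]
  refine (QuotientGroup.eq (s := corner R)).2
    ⟨Multiplicative.ofAdd (-(A.1.1 0 1 * r.toAdd)), ?_⟩
  rw [eq_inv_mul_iff_mul_eq]
  refine U3.ext' fun k l => ?_
  rw [mul_elem_apply, mul_elem_apply, elem_mul_apply, mul_elem_apply]
  have h1 := A.2.1
  have h2 := A.2.2
  fin_cases k <;> fin_cases l <;> simp [h1, h2]

theorem pr_mul (i j : Fin 4) (h : (i, j) ≠ (0, 3)) (x y : Ubar3 R) (A B : U3 R)
    (hx : proj R A = x) (hy : proj R B = y) :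
    pr i j h (x * y) = ∑ k, A.1.1 i k * B.1.1 k j := by
  subst hx hy
  rw [← map_mul, pr_proj]
  exact Matrix.mul_apply

theorem pr_succ_mul (i : Fin 3) (h : (i.castSucc, i.succ) ≠ (0, 3)) (x y : Ubar3 R) :
    pr i.castSucc i.succ h (x * y) = pr i.castSucc i.succ h x + pr i.castSucc i.succ h y := by
  obtain ⟨A, rfl⟩ := proj_surjective x
  obtain ⟨B, rfl⟩ := proj_surjective y
  rw [pr_mul _ _ _ _ _ A B rfl rfl]
  change _ = A.1.1 _ _ + B.1.1 _ _
  have a1 := A.2.1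
  have a2 := A.2.2
  have b1 := B.2.1
  have b2 := B.2.2
  fin_cases i <;> simp [Fin.sum_univ_four, a1, a2, b1, b2] <;> ring

theorem pr_02_mul (x y : Ubar3 R) :
    pr 0 2 (by decide) (x * y) = pr 0 2 (by decide) x + pr 0 2 (by decide) y +
      pr 0 1 (by decide) x * pr 1 2 (by decide) y := by
  obtain ⟨A, rfl⟩ := proj_surjective x
  obtain ⟨B, rfl⟩ := proj_surjective y
  rw [pr_mul _ _ _ _ _ A B rfl rfl]
  change _ = A.1.1 _ _ + B.1.1 _ _ + A.1.1 _ _ * B.1.1 _ _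
  have a1 := A.2.1
  have a2 := A.2.2
  have b1 := B.2.1
  have b2 := B.2.2
  simp [Fin.sum_univ_four, a1, b1, b2]
  ring

variable (R) in
/-- The central extension `0 → R⁺ → 𝕌₃(R) → 𝕌̄₃(R) → 1`. -/
def uExt : GroupExtension (Multiplicative R) (U3 R) (Ubar3 R) where
  inl := elem 0 3 (by decide)
  rightHom := proj R
  inl_injective := by
    intro r s h
    have h' := congrArg (fun A : U3 R => A.1.1 0 3) h
    simpa [elem] using h'
  range_inl_eq_ker_rightHom := (QuotientGroup.ker_mk' (corner R)).symm
  rightHom_surjective := proj_surjective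

end Matrices

/-! ### Homomorphisms into `𝕌̄₃(ℤ/m)` -/

section Representations

variable (m : ℕ)

/-- The class `α ∈ H²(𝕌̄₃(ℤ/m), ℤ/m)` of `0 → ℤ/m → 𝕌₃(ℤ/m) → 𝕌̄₃(ℤ/m) → 1`. -/
def alpha : H2 m (Ubar3 (ZMod m)) := extClass (uExt (ZMod m)) corner_le_center

variable {m} {G : Type*} [Group G] [TopologicalSpace G]

theorem continuous_entry (ρ : G →ₜ* Ubar3 (ZMod m)) (i j : Fin 4) (h : (i, j) ≠ (0, 3)) :
    Continuous fun g => pr i j h (ρ g) :=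
  continuous_of_discreteTopology.comp ρ.continuous_toFun

/-- `ρ̄₁₂ ∈ H¹(G, ℤ/m)`. -/
def rho12 (ρ : G →ₜ* Ubar3 (ZMod m)) : H1 m G :=
  ⟨fun g => pr 0 1 (by decide) (ρ g), continuous_entry ρ _ _ (by decide), fun g h => by
    simp only [map_mul]
    exact pr_succ_mul 0 (by decide) _ _⟩

/-- `ρ̄₃₄ ∈ H¹(G, ℤ/m)`. -/
def rho34 (ρ : G →ₜ* Ubar3 (ZMod m)) : H1 m G :=
  ⟨fun g => pr 2 3 (by decide) (ρ g), continuous_entry ρ _ _ (by decide), fun g h => by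
    simp only [map_mul]
    exact pr_succ_mul 2 (by decide) _ _⟩

/-- `M₁ = Ker ρ̄₁₂`. -/
def M1 (ρ : G →ₜ* Ubar3 (ZMod m)) : Subgroup G := H1.ker (rho12 ρ)

/-- `M₃ = Ker ρ̄₃₄`. -/
def M3 (ρ : G →ₜ* Ubar3 (ZMod m)) : Subgroup G := H1.ker (rho34 ρ)

/-- `M = M₁ ∩ M₃`, as a subgroup of `M₁`. -/
def M (ρ : G →ₜ* Ubar3 (ZMod m)) : Subgroup (M1 ρ) := (M1 ρ ⊓ M3 ρ).subgroupOf (M1 ρ)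

theorem isOpen_M (ρ : G →ₜ* Ubar3 (ZMod m)) : IsOpen (M ρ : Set (M1 ρ)) :=
  ((H1.isOpen_ker (rho12 ρ)).inter (H1.isOpen_ker (rho34 ρ))).preimage continuous_subtype_val

instance finiteIndex_M [NeZero m] (ρ : G →ₜ* Ubar3 (ZMod m)) : (M ρ).FiniteIndex := by
  have h1 : (M1 ρ).FiniteIndex := H1.finiteIndex_ker (rho12 ρ)
  have h3 : (M3 ρ).FiniteIndex := H1.finiteIndex_ker (rho34 ρ)
  unfold M
  infer_instance

/-- `ω = Res_{M₁}(ρ̄₁₃) ∈ H¹(M₁, ℤ/m)`. -/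
def omega (ρ : G →ₜ* Ubar3 (ZMod m)) : H1 m (M1 ρ) :=
  ⟨fun g => pr 0 2 (by decide) (ρ g),
    (continuous_entry ρ _ _ (by decide)).comp continuous_subtype_val, fun g h => by
    have hg : pr 0 1 (by decide) (ρ g) = 0 := H1.mem_ker.1 g.2
    simp only [Subgroup.coe_mul, map_mul, pr_02_mul, hg, zero_mul, add_zero]⟩

theorem continuous_elem24_comp (lam : H1 m G) :
    Continuous fun g => (elem24 (Multiplicative.ofAdd (-lam.1 g)) : Ubar3 (ZMod m)) :=
  (continuous_of_discreteTopology
    (f := fun r : ZMod m => (elem24 (Multiplicative.ofAdd (-r)) : Ubar3 (ZMod m)))).comp lam.2.1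

/-- The continuous homomorphism `ρ̄ · (I - λ E_{24}) : g ↦ ρ̄(g) (I - λ(g) E_{24})`. -/
def modify24 (ρ : G →ₜ* Ubar3 (ZMod m)) (lam : H1 m G) : G →ₜ* Ubar3 (ZMod m) where
  toMonoidHom := MonoidHom.mk' (fun g => ρ g * elem24 (Multiplicative.ofAdd (-lam.1 g)))
    (fun g h => by
      rw [map_mul, lam.2.2, neg_add, ofAdd_add, map_mul]
      have hc := elem24_comm (Multiplicative.ofAdd (-lam.1 g)) (ρ h)
      rw [mul_assoc (ρ g), mul_assoc (ρ g), ← mul_assoc (ρ h), hc, mul_assoc])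
  continuous_toFun := ρ.continuous_toFun.mul (continuous_elem24_comp lam)

end Representations

end UniTri

end

/-! The section of $\mathbb U_3\to\bar{\mathbb U}_3$ with upper right entry $0$ shows that $\alpha$
is represented by $(x,y)\mapsto x_{12}y_{24}+x_{13}y_{34}$ (`factorSet_cornerSection`). Everything
is read off from this cocycle.

On $M_1$ the first term vanishes, so the restriction of $\bar\rho^*\alpha$ is
$\omega\cup\bar\rho_{34}$ (`res_map_alpha`). Since $M$ is the kernel of $\bar\rho_{34}$ on $M_1$,
exactness at $H^1$ in (KF1) for $N=M_1$ makes this vanish exactly when $\omega$ is a corestriction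
from $M$: (a) ⇔ (c).

Replacing $\bar\rho$ by $\bar\rho(I-\lambda E_{24})$ subtracts $\bar\rho_{12}\cup\lambda$ from
$\bar\rho^*\alpha$ (`map_modify24_alpha`), so (b) says that $\bar\rho^*\alpha$ has the form
$\bar\rho_{12}\cup\lambda$. Such a class dies on $M_1$; conversely, exactness at $H^2$ for $N=G$ and
anticommutativity give this form to every class that dies on $M_1$: (a) ⇔ (b). -/

namespace UniTri

/-! ### Functoriality of $H^2$, cup products, and the two exactness statements of (KF1) -/

section Degree2

variable {m : ℕ} {G : Type*} [Group G] [TopologicalSpace G]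
  {K : Type*} [Group K] [TopologicalSpace K] {L : Type*} [Group L] [TopologicalSpace L]

theorem H2.map_comp_apply (φ : G →ₜ* K) (ψ : K →ₜ* L) (a : H2 m L) :
    H2.map (ψ.comp φ) a = H2.map φ (H2.map ψ a) := by
  induction a using QuotientAddGroup.induction_on
  rfl

theorem H2.map_id_apply (a : H2 m G) : H2.map (ContinuousMonoidHom.id G) a = a := by
  induction a using QuotientAddGroup.induction_on
  rfl

theorem H2.mk_eq_mk_iff (a b : Z2 m G) :
    (QuotientAddGroup.mk a : H2 m G) = QuotientAddGroup.mk b ↔ -a.1 + b.1 ∈ B2 m G :=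
  QuotientAddGroup.eq

theorem cupRight_apply (χ ψ : H1 m G) {z : Z2 m G} (hz : ∀ g h, z.1 (g, h) = ψ.1 g * χ.1 h) :
    cupRight χ ψ = QuotientAddGroup.mk z :=
  congrArg QuotientAddGroup.mk (Subtype.ext (funext fun p => (hz p.1 p.2).symm))

/-- Pullback commutes with the cup product. -/
theorem H2.map_cupRight (φ : G →ₜ* K) (χ ψ : H1 m K) :
    H2.map φ (cupRight χ ψ) = cupRight (H1.map φ χ) (H1.map φ ψ) := rfl

/-- The cup product of classes of degree one is anticommutative. -/
theorem cupRight_anticomm (χ ψ : H1 m G) : cupRight χ ψ = -cupRight ψ χ := by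
  -- For $c=\psi\chi$ one has $c(h)-c(gh)+c(g)=-\psi(g)\chi(h)-\chi(g)\psi(h)$, which is minus the
  -- first cocycle plus the negated second one.
  refine (H2.mk_eq_mk_iff _ (-_)).2 ⟨fun g => ψ.1 g * χ.1 g, ψ.2.1.mul χ.2.1, fun g h => ?_⟩
  change -(ψ.1 g * χ.1 h) + -(χ.1 g * ψ.1 h) = _
  simp only [χ.2.2, ψ.2.2]
  ring

/-- The isomorphism of `G` onto its improper subgroup. -/
def toTop (G : Type*) [Group G] [TopologicalSpace G] : G →ₜ* (⊤ : Subgroup G) where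
  toMonoidHom := (Subgroup.topEquiv (G := G)).symm.toMonoidHom
  continuous_toFun := Continuous.subtype_mk continuous_id _

/-- Under (KF1), a class of `H²(G, ℤ/m)` that vanishes on `Ker χ` is a multiple of `χ`. -/
theorem KF1.exists_cupRight_eq [NeZero m] [IsTopologicalGroup G] (hG : KF1 m G) (χ : H1 m G)
    (a : H2 m G) (ha : H2.res (H1.ker χ) a = 0) : ∃ ψ : H1 m G, cupRight χ ψ = a := by
  -- (KF1) speaks of subgroups, so the case $N=G$ is the subgroup `⊤`: the class is moved there
  -- along `ι` and the resulting $\psi$ is brought back along `toTop G`.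
  set ι := incl (⊤ : Subgroup G)
  -- Identifies the kernel formed inside `⊤` with the one formed inside $G$, so that the vanishing
  -- in `ha` can be transported.
  let j : H1.ker (H1.map ι χ) →ₜ* H1.ker χ :=
    { toFun := fun g => ⟨g.1.1, g.2⟩
      map_one' := rfl
      map_mul' := fun _ _ => rfl
      continuous_toFun :=
        (continuous_subtype_val.comp continuous_subtype_val).subtype_mk fun g => g.2 }
  have hres : H2.res (H1.ker (H1.map ι χ)) (H2.map ι a) = 0 := by
    have h : H2.map j (H2.map (incl (H1.ker χ)) a) = 0 := by
      change H2.map j (H2.res (H1.ker χ) a) = 0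
      rw [ha, map_zero]
    rw [← H2.map_comp_apply] at h
    rw [H2.res, ← H2.map_comp_apply]
    exact h
  obtain ⟨ψ, hψ⟩ := ((hG ⊤ inferInstance isOpen_univ (H1.map ι χ)).2 _).1 hres
  refine ⟨H1.map (toTop G) ψ, ?_⟩
  have h := congrArg (H2.map (toTop G)) hψ
  rw [H2.map_cupRight, ← H2.map_comp_apply] at h
  exact h.trans (H2.map_id_apply a)

/-- Under (KF1), `ψ ∪ χ = 0` if and only if `ψ` is a corestriction from `Ker χ`. -/
theorem KF1.cupRight_eq_zero_iff [NeZero m] [IsTopologicalGroup G] (hG : KF1 m G)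
    {N : Subgroup G} (hN : N.Normal) (hN' : IsOpen (N : Set G)) (χ ψ : H1 m N)
    {H : Subgroup N} [H.FiniteIndex] (hH : IsOpen (H : Set N)) (hχ : H = H1.ker χ) :
    cupRight χ ψ = 0 ↔ ∃ η : H1 m H, H1.cor H hH η = ψ := by
  -- `H` is kept separate from the kernel because the type of `H1.cor` depends on the subgroup; this
  -- admits `M ρ`, which equals the kernel only through `M_eq_ker`.
  subst hχ
  exact (hG N hN hN' χ).1 ψ

end Degree2

/-! ### An explicit cocycle for $\alpha$ and its pullbacks -/

section Cocycle

variable {R : Type*} [CommRing R]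

theorem proj_mul_corner (A : U3 R) (r : Multiplicative R) :
    proj R (A * elem 0 3 (by decide) r) = proj R A :=
  ((QuotientGroup.eq (s := corner R)).2 ⟨r, by group⟩).symm

/-- The section of `𝕌₃(R) → 𝕌̄₃(R)` whose values have upper right entry `0`. -/
noncomputable def cornerSection : (uExt R).Section where
  toFun x := Function.surjInv proj_surjective x *
    elem 0 3 (by decide) (Multiplicative.ofAdd (-(Function.surjInv proj_surjective x).1.1 0 3))
  rightInverse_rightHom x :=
    (proj_mul_corner _ _).trans (Function.surjInv_eq proj_surjective x)

theorem proj_cornerSection (x : Ubar3 R) : proj R (cornerSection x) = x :=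
  cornerSection.rightInverse_rightHom x

theorem cornerSection_corner (x : Ubar3 R) : (cornerSection x).1.1 0 3 = 0 := by
  change (Function.surjInv proj_surjective x * elem 0 3 _ _).1.1 0 3 = 0
  rw [mul_elem_apply, if_pos rfl, (Function.surjInv proj_surjective x).2.1]
  simp

theorem cornerSection_apply (x : Ubar3 R) (i j : Fin 4) (h : (i, j) ≠ (0, 3)) :
    (cornerSection x).1.1 i j = pr i j h x := by
  conv_rhs => rw [← proj_cornerSection x]
  rfl

theorem pr_mul_elem24 (x : Ubar3 R) (r : Multiplicative R) (i j : Fin 4) (h : (i, j) ≠ (0, 3)) :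
    pr i j h (x * elem24 r) =
      pr i j h x + if j = 3 then pr i 1 (by simp) x * r.toAdd else 0 := by
  obtain ⟨A, rfl⟩ := proj_surjective x
  exact mul_elem_apply A r 1 3 i j (by decide)

variable {m : ℕ}

/-- Compare upper right entries in $(I+rE_{14})\,s(xy)=s(x)s(y)$, where $r$ is the factor set. As
$s(xy)$ has corner $0$ and last diagonal entry $1$, the left side gives $r$. On the right, the outer
two of the four summands contain a corner of $s(x)$ or $s(y)$ and vanish. -/
theorem factorSet_cornerSection (x y : Ubar3 (ZMod m)) :
    factorSet (uExt (ZMod m)) cornerSection (x, y) =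
      pr 0 1 (by decide) x * pr 1 3 (by decide) y +
        pr 0 2 (by decide) x * pr 2 3 (by decide) y := by
  have e := inl_factorSet (uExt (ZMod m)) cornerSection x y
  rw [eq_mul_inv_iff_mul_eq] at e
  have e' := congrArg (fun A : U3 (ZMod m) => A.1.1 0 3) e
  have hl := elem_mul_apply (cornerSection (x * y) : U3 (ZMod m))
    (Multiplicative.ofAdd (factorSet (uExt (ZMod m)) cornerSection (x, y))) 0 3 0 3 (by decide)
  rw [cornerSection_corner, if_pos rfl, (cornerSection (x * y)).2.1, zero_add, mul_one] at hl
  have hr : (cornerSection x * cornerSection y : U3 (ZMod m)).1.1 0 3 =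
      ∑ k, (cornerSection x).1.1 0 k * (cornerSection y).1.1 k 3 := Matrix.mul_apply
  rw [Fin.sum_univ_four, cornerSection_corner, cornerSection_corner, mul_zero, zero_mul, zero_add,
    add_zero, cornerSection_apply x 0 1 (by decide), cornerSection_apply x 0 2 (by decide),
    cornerSection_apply y 1 3 (by decide), cornerSection_apply y 2 3 (by decide)] at hr
  exact hl.symm.trans (e'.trans hr)

variable (m) in
/-- The cocycle `(x, y) ↦ x₁₂ y₂₄ + x₁₃ y₃₄`, which represents `α`. -/
noncomputable def alphaCocycle : Z2 m (Ubar3 (ZMod m)) :=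
  ⟨factorSet (uExt (ZMod m)) cornerSection, factorSet_mem _ corner_le_center _⟩

theorem alpha_eq : alpha m = QuotientAddGroup.mk (alphaCocycle m) :=
  extClass_eq _ corner_le_center cornerSection

variable {G : Type*} [Group G] [TopologicalSpace G] (ρ : G →ₜ* Ubar3 (ZMod m))

theorem map_alpha : H2.map ρ (alpha m) = QuotientAddGroup.mk (Z2.map ρ (alphaCocycle m)) := by
  rw [alpha_eq]
  rfl

theorem map_alphaCocycle_apply (g h : G) :
    (Z2.map ρ (alphaCocycle m)).1 (g, h) =
      pr 0 1 (by decide) (ρ g) * pr 1 3 (by decide) (ρ h) +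
        pr 0 2 (by decide) (ρ g) * pr 2 3 (by decide) (ρ h) :=
  factorSet_cornerSection _ _

/-- On `M₁` the class `ρ̄^* α` is the cup product `ω ∪ ρ̄₃₄`. -/
theorem res_map_alpha :
    H2.res (M1 ρ) (H2.map ρ (alpha m)) =
      cupRight (H1.res (M1 ρ) (rho34 ρ)) (omega ρ) := by
  rw [map_alpha]
  refine (cupRight_apply _ _ (z := Z2.map (incl (M1 ρ)) (Z2.map ρ (alphaCocycle m)))
    fun g h => ?_).symm
  refine (map_alphaCocycle_apply ρ (g : G) (h : G)).trans ?_
  have hg : pr 0 1 (by decide) (ρ g) = 0 := H1.mem_ker.1 g.2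
  rw [hg, zero_mul, zero_add]
  rfl

/-- Multiplication by `I - λ E₂₄` changes the pullback of `α` by `ρ̄₁₂ ∪ λ`. -/
theorem map_modify24_alpha (lam : H1 m G) :
    H2.map (modify24 ρ lam) (alpha m) = H2.map ρ (alpha m) - cupRight lam (rho12 ρ) := by
  rw [map_alpha, map_alpha]
  refine congrArg QuotientAddGroup.mk (a₂ := Z2.map ρ (alphaCocycle m) - ⟨_, _⟩)
    (Subtype.ext (funext fun ⟨g, h⟩ => ?_))
  change _ = (Z2.map ρ (alphaCocycle m)).1 (g, h) - pr 0 1 (by decide) (ρ g) * lam.1 h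
  rw [map_alphaCocycle_apply, map_alphaCocycle_apply]
  change pr 0 1 (by decide) (ρ g * elem24 _) * pr 1 3 (by decide) (ρ h * elem24 _) +
    pr 0 2 (by decide) (ρ g * elem24 _) * pr 2 3 (by decide) (ρ h * elem24 _) = _
  -- The factor $I-\lambda E_{24}$ adds $-\lambda(h)$ times column 2 to column 4. The diagonal $1$
  -- turns the $(2,4)$-entry into $\bar\rho_{24}(h)-\lambda(h)$, and the $0$ below it leaves the
  -- $(3,4)$-entry alone.
  have h11 : pr 1 1 (by decide) (ρ h) = 1 := by
    obtain ⟨A, hA⟩ := proj_surjective (ρ h)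
    rw [← hA, pr_proj, A.2.1]
  have h21 : pr 2 1 (by decide) (ρ h) = 0 := by
    obtain ⟨A, hA⟩ := proj_surjective (ρ h)
    rw [← hA, pr_proj, A.2.2 2 1 (by decide)]
  simp only [pr_mul_elem24, h11, h21, if_true, toAdd_ofAdd]
  rw [if_neg (by decide), if_neg (by decide)]
  ring

theorem M_eq_ker : M ρ = H1.ker (H1.res (M1 ρ) (rho34 ρ)) := by
  ext g
  exact ⟨fun h => h.2, fun h => ⟨g.2, h⟩⟩

theorem res_cupRight_rho12 (lam : H1 m G) :
    H2.res (M1 ρ) (cupRight lam (rho12 ρ)) = 0 := by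
  have h : H1.map (incl (M1 ρ)) (rho12 ρ) = 0 := Subtype.ext (funext fun g => H1.mem_ker.1 g.2)
  rw [H2.res, H2.map_cupRight, h, map_zero]

end Cocycle

end UniTri

theorem proposition6p1 (m : ℕ) [NeZero m] (hm : 2 ≤ m)
    {G : Type*} [Group G] [TopologicalSpace G] [IsTopologicalGroup G]
    [CompactSpace G] [T2Space G] [TotallyDisconnectedSpace G]
    (hKF1 : UniTri.KF1 m G) (ρ : G →ₜ* UniTri.Ubar3 (ZMod m)) :
    List.TFAE [
      UniTri.H2.res (UniTri.M1 ρ) (UniTri.H2.map ρ (UniTri.alpha m)) = 0,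
      ∃ lam : UniTri.H1 m G, UniTri.H2.map (UniTri.modify24 ρ lam) (UniTri.alpha m) = 0,
      ∃ η : UniTri.H1 m (UniTri.M ρ),
        UniTri.H1.cor (UniTri.M ρ) (UniTri.isOpen_M ρ) η = UniTri.omega ρ] := by
  tfae_have 1 ↔ 3 := by
    rw [UniTri.res_map_alpha]
    exact hKF1.cupRight_eq_zero_iff (N := UniTri.M1 ρ) (MonoidHom.normal_ker _)
      (UniTri.H1.isOpen_ker _) _ _ _ (UniTri.M_eq_ker ρ)
  tfae_have 1 → 2 := by
    intro h
    obtain ⟨ψ, hψ⟩ := hKF1.exists_cupRight_eq (UniTri.rho12 ρ) _ h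
    -- Exactness yields $\bar\rho^*\alpha=\psi\cup\bar\rho_{12}$, whereas the modification subtracts
    -- $\bar\rho_{12}\cup\lambda$; swapping the factors costs the sign.
    refine ⟨-ψ, ?_⟩
    rw [UniTri.map_modify24_alpha, UniTri.cupRight_anticomm, map_neg, hψ, neg_neg, sub_self]
  tfae_have 2 → 1 := by
    rintro ⟨lam, h⟩
    rw [UniTri.map_modify24_alpha, sub_eq_zero] at h
    rw [h, UniTri.res_cupRight_rho12]
  tfae_finish
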